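/- Call a function $G:[0,\infty)\to[0,\infty)$ with $G(0)>0$ a kernel. A kernel $G$ is said to preserve nonnegativity if, for all $K\ge 1$, all $x_1,\dots,x_K\in\mathbb{R}$ and all $0\le t_1<\dots<t_K$ such that $$\sum_{k'=1}^{k} x_{k'}\,G(t_k-t_{k'})\ \ge\ 0\qquad\text{for every } k\in\{1,\dots,K\}, \tag{1}$$ one has $$\sum_{k\,:\,t_k\le t} x_k\,G(t-t_k)\ \ge\ 0\qquad\text{for every } t\ge 0, \tag{2}$$ where an empty sum is $0$. A kernel $G$ is completely monotone if it is $C^\infty$ on $(0,\infty)$ with $(-1)^nG^{(n)}\ge 0$ on $(0,\infty)$ for all $n\ge 0$, and $G(0)=\lim_{t\to 0,\,t>0}G(t)$. Theorem. Every completely monotone kernel preserves nonnegativity. More generally, if $\mu$ is a nonzero finite Borel measure on $\mathbb{R}$ such that $G(t)=\int_{\mathbb{R}}e^{-\rho t}\,\mu(d\rho)<\infty$ for all $t\ge 0$, then $G$ is a kernel that preserves nonnegativity. If, moreover, $\mu$ is not concentrated at a single point (that is, $\mu$ is not of the form $\lambda\delta_{\rho_1}$ with $\lambda>0$, $\rho_1\in\mathbb{R}$),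 then for all $K\ge 1$, all $x_1,\dots,x_K\in\mathbb{R}$ with $x_1>0$ and all $0\le t_1<\dots<t_K$ satisfying (1), the inequality (2) is strict for every $t>t_1$ with $t\notin\{t_2,\dots,t_K\}$. -/

import Mathlib

open MeasureTheory Set
open scoped ContDiff

/-- A kernel `ℝ₊ → ℝ₊` is represented by a function `G : ℝ → ℝ` of which only the values on
`[0, ∞)` matter. `Admissible G x t` says that `0 ≤ t₁ < ⋯ < t_K` and that
`∑_{k' ≤ k} x_{k'} G(t_k - t_{k'}) ≥ 0` for every `k ∈ {1, …, K}`. The indices `1, …, K` are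
represented by `Fin (n + 1)` with `K = n + 1`, so that `x 0`, `t 0` stand for `x₁`, `t₁`. -/
structure Admissible (G : ℝ → ℝ) {n : ℕ} (x t : Fin (n + 1) → ℝ) : Prop where
  nonneg_times : ∀ k, 0 ≤ t k
  strictMono : StrictMono t
  nonneg_sums : ∀ k, 0 ≤ ∑ k' ∈ Finset.Iic k, x k' * G (t k - t k')

/-- The process `X_s = ∑_{k : t_k ≤ s} x_k G(s - t_k)` (an empty sum is `0`). -/
noncomputable def kernelProcess (G : ℝ → ℝ) {n : ℕ} (x t : Fin (n + 1) → ℝ) (s : ℝ) : ℝ :=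
  ∑ k with t k ≤ s, x k * G (s - t k)

/-- `G` is a kernel (nonnegative on `[0, ∞)`, with `G 0 > 0`) that preserves nonnegativity. -/
structure PreservesNonnegativity (G : ℝ → ℝ) : Prop where
  nonneg : ∀ s, 0 ≤ s → 0 ≤ G s
  pos_zero : 0 < G 0
  preserves : ∀ (n : ℕ) (x t : Fin (n + 1) → ℝ), Admissible G x t →
    ∀ s, 0 ≤ s → 0 ≤ kernelProcess G x t s

/-- `G : ℝ₊ → ℝ₊` is completely monotone: it is `C^∞` on `(0, ∞)` with `(-1)ⁿ G⁽ⁿ⁾ ≥ 0` there for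
all `n ≥ 0`, and its value at `0` is the (finite) limit `G(0+)`. -/
structure CompletelyMonotoneKernel (G : ℝ → ℝ) : Prop where
  contDiffOn : ContDiffOn ℝ ∞ G (Ioi 0)
  sign : ∀ (n : ℕ) (s : ℝ), 0 < s → 0 ≤ (-1 : ℝ) ^ n * iteratedDerivWithin n G (Ioi 0) s
  continuous_zero : ContinuousWithinAt G (Ici 0) 0

/-! For `G` the Laplace transform of `μ`, the process after `t k` is the `μ`-integral of a density
in `ρ` that is multiplied by `exp (-ρ * h)` between jumps and shifted by the constant `x k` at
jumps. Nonnegativity of its integral alone does not survive the decay. The stronger invariant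
`DecreasingLowerMeans` does: means over lower sets decrease as the set grows, and the total integral
is nonnegative. A shift moves all means equally, and (1) keeps the total nonnegative. Decay
preserves the invariant by Abel summation (`integral_mul_exp_eq`): nonnegative integrals over all
half-lines `Iic v` force a nonnegative integral against a decaying exponential. If `μ` is not a
point mass, decay makes the means over a suitable half-line and over the whole line differ strictly,
which gives strict positivity.

Bernstein's theorem is not needed for completely monotone `G`. The Taylor series of `G` at `a` makes
`G ∘ expTime a` the Laplace transform of a discrete measure, `expTime a s` tends to `s` as `a → ∞`,
and preservation of nonnegativity passes to pointwise limits (`PreservesNonnegativity.of_tendsto`).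
-/

open Filter Topology

/-! ### Abel summation against a decaying exponential -/

section AbelSummation

variable {μ : Measure ℝ} {f : ℝ → ℝ} {h : ℝ}

/-- The integrand whose two iterated integrals express the integral of `f ρ * exp (-ρ * h)`
through the integrals of `f` over half-lines. -/
noncomputable def abelIntegrand (f : ℝ → ℝ) (h : ℝ) (p : ℝ × ℝ) : ℝ :=
  {p : ℝ × ℝ | p.1 ≤ p.2}.indicator (fun p => f p.1 * (h * Real.exp (-h * p.2))) p

lemma abelIntegrand_left (f : ℝ → ℝ) (h ρ : ℝ) :
    (fun v => abelIntegrand f h (ρ, v)) =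
      (Ici ρ).indicator (fun v => f ρ * (h * Real.exp (-h * v))) := by
  ext v
  simp [abelIntegrand, indicator_apply]

lemma abelIntegrand_right (f : ℝ → ℝ) (h v : ℝ) :
    (fun ρ => abelIntegrand f h (ρ, v)) =
      (Iic v).indicator (fun ρ => f ρ * (h * Real.exp (-h * v))) := by
  ext ρ
  simp [abelIntegrand, indicator_apply]

lemma integral_Ici_exp (hh : 0 < h) (ρ : ℝ) :
    ∫ v in Ici ρ, h * Real.exp (-h * v) = Real.exp (-ρ * h) := by
  rw [integral_Ici_eq_integral_Ioi, integral_const_mul, integral_exp_mul_Ioi (by linarith)]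
  rw [neg_div_neg_eq, mul_div_cancel₀ _ hh.ne']
  ring_nf

/-- Integrating the norm in `v` first gives `|f ρ| * exp (-ρ * h)`. Since `ρ` may be arbitrarily
negative, its integrability does not follow from that of `f`. -/
lemma integrable_abelIntegrand [IsFiniteMeasure μ] (hh : 0 < h) (hf : Integrable f μ)
    (hfe : Integrable (fun ρ => f ρ * Real.exp (-ρ * h)) μ) :
    Integrable (abelIntegrand f h) (μ.prod volume) := by
  have hm : AEStronglyMeasurable (abelIntegrand f h) (μ.prod volume) := by
    refine AEStronglyMeasurable.indicator ?_ (measurableSet_le measurable_fst measurable_snd)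
    refine (hf.aestronglyMeasurable.comp_fst).mul ?_
    exact Continuous.aestronglyMeasurable (by fun_prop)
  rw [integrable_prod_iff hm]
  constructor
  · refine Eventually.of_forall fun ρ => ?_
    rw [abelIntegrand_left, integrable_indicator_iff measurableSet_Ici]
    refine Integrable.const_mul ?_ _
    refine Integrable.const_mul ?_ _
    rw [← IntegrableOn, integrableOn_Ici_iff_integrableOn_Ioi]
    exact integrableOn_exp_mul_Ioi (by linarith) ρ
  · refine hfe.norm.congr (Eventually.of_forall fun ρ => ?_)
    have h1 : (fun v => ‖abelIntegrand f h (ρ, v)‖) =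
        (Ici ρ).indicator (fun v => |f ρ| * (h * Real.exp (-h * v))) := by
      ext v
      rw [show abelIntegrand f h (ρ, v) = _ from congrFun (abelIntegrand_left f h ρ) v,
        norm_indicator_eq_indicator_norm]
      refine congrFun (congrArg _ ?_) v
      ext w
      simp [abs_of_pos hh]
    simp only [h1]
    rw [integral_indicator measurableSet_Ici, integral_const_mul, integral_Ici_exp hh]
    simp

lemma integral_abelIntegrand_right (f : ℝ → ℝ) (h v : ℝ) :
    ∫ ρ, abelIntegrand f h (ρ, v) ∂μ = (∫ ρ in Iic v, f ρ ∂μ) * (h * Real.exp (-h * v)) := by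
  rw [abelIntegrand_right, integral_indicator measurableSet_Iic, integral_mul_const]

/-- Write `exp (-ρ * h)` as the integral of `h * exp (-h * v)` over `v ≥ ρ` and apply Fubini. -/
lemma integral_mul_exp_eq [IsFiniteMeasure μ] (hh : 0 < h) (hf : Integrable f μ)
    (hfe : Integrable (fun ρ => f ρ * Real.exp (-ρ * h)) μ) :
    ∫ ρ, f ρ * Real.exp (-ρ * h) ∂μ =
      ∫ v, (∫ ρ in Iic v, f ρ ∂μ) * (h * Real.exp (-h * v)) := by
  have hs := integral_integral_swap (f := fun ρ v => abelIntegrand f h (ρ, v))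
    (integrable_abelIntegrand hh hf hfe)
  simp only [integral_abelIntegrand_right] at hs
  rw [← hs]
  refine integral_congr_ae (Eventually.of_forall fun ρ => ?_)
  simp only [abelIntegrand_left]
  rw [integral_indicator measurableSet_Ici, integral_const_mul, integral_Ici_exp hh]

/-- If all integrals of `f` over left half-lines are nonnegative, then `f` has a nonnegative
integral against a decaying exponential. -/
lemma integral_mul_exp_nonneg [IsFiniteMeasure μ] (hh : 0 < h) (hf : Integrable f μ)
    (hfe : Integrable (fun ρ => f ρ * Real.exp (-ρ * h)) μ)
    (hF : ∀ v, 0 ≤ ∫ ρ in Iic v, f ρ ∂μ) :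
    0 ≤ ∫ ρ, f ρ * Real.exp (-ρ * h) ∂μ := by
  rw [integral_mul_exp_eq hh hf hfe]
  exact integral_nonneg fun v => mul_nonneg (hF v) (by positivity)

lemma tendsto_setIntegral_Iic (hf : Integrable f μ) (v₀ : ℝ) :
    Tendsto (fun v => ∫ ρ in Iic v, f ρ ∂μ) (𝓝[>] v₀) (𝓝 (∫ ρ in Iic v₀, f ρ ∂μ)) := by
  simp only [← integral_indicator measurableSet_Iic]
  refine tendsto_integral_filter_of_dominated_convergence (fun ρ => ‖f ρ‖) ?_ ?_ hf.norm ?_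
  · exact Eventually.of_forall fun v => hf.aestronglyMeasurable.indicator measurableSet_Iic
  · exact Eventually.of_forall fun v => Eventually.of_forall fun ρ => norm_indicator_le_norm_self _ _
  · refine Eventually.of_forall fun ρ => ?_
    refine tendsto_const_nhds.congr' ?_
    rcases le_or_gt ρ v₀ with hρ | hρ
    · filter_upwards [self_mem_nhdsWithin] with v hv
      rw [indicator_of_mem (show ρ ∈ Iic v₀ from hρ),
        indicator_of_mem (show ρ ∈ Iic v from hρ.trans (le_of_lt hv))]
    · filter_upwards [Ioo_mem_nhdsGT hρ] with v hv
      rw [indicator_of_notMem (show ρ ∉ Iic v₀ from not_le.2 hρ),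
        indicator_of_notMem (show ρ ∉ Iic v from not_le.2 hv.2)]

/-- Right-continuity of the half-line integrals spreads positivity from `v₀` to an interval of
positive length. -/
lemma integral_mul_exp_pos [IsFiniteMeasure μ] (hh : 0 < h) (hf : Integrable f μ)
    (hfe : Integrable (fun ρ => f ρ * Real.exp (-ρ * h)) μ)
    (hF : ∀ v, 0 ≤ ∫ ρ in Iic v, f ρ ∂μ) {v₀ : ℝ} (hv₀ : 0 < ∫ ρ in Iic v₀, f ρ ∂μ) :
    0 < ∫ ρ, f ρ * Real.exp (-ρ * h) ∂μ := by
  rw [integral_mul_exp_eq hh hf hfe]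
  have hint := (integrable_abelIntegrand hh hf hfe).integral_prod_right
  simp only [integral_abelIntegrand_right] at hint
  rw [integral_pos_iff_support_of_nonneg (fun v => mul_nonneg (hF v) (by positivity)) hint]
  obtain ⟨w, hw, hsub⟩ := mem_nhdsGT_iff_exists_Ioo_subset.1
    ((tendsto_setIntegral_Iic hf v₀).eventually (lt_mem_nhds hv₀))
  refine lt_of_lt_of_le ?_ (measure_mono (show Ioo v₀ w ⊆ _ from fun v hv => ?_))
  · simpa using hw
  · have : 0 < ∫ ρ in Iic v, f ρ ∂μ := hsub hv
    exact (mul_pos this (by positivity)).ne'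

end AbelSummation

/-! ### Means over lower sets -/

/-- The support contains two distinct points; any `r` strictly between them works. -/
lemma exists_Iic_of_not_dirac {μ : Measure ℝ} [IsFiniteMeasure μ] (hμ : ∀ ρ : ℝ, μ {ρ}ᶜ ≠ 0) :
    ∃ r, 0 < μ.real (Iic r) ∧ μ.real (Iic r) < μ.real univ := by
  have key : ∀ x y : ℝ, x ∈ μ.support → y ∈ μ.support → x < y →
      ∃ r, 0 < μ.real (Iic r) ∧ μ.real (Iic r) < μ.real univ := by
    intro x y hx hy hxy
    obtain ⟨r, hxr, hry⟩ := exists_between hxy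
    refine ⟨r, ?_, ?_⟩
    · exact ENNReal.toReal_pos ((Measure.mem_support_iff_forall x).1 hx _ (Iic_mem_nhds hxr)).ne'
        (measure_ne_top _ _)
    · have h1 : 0 < μ.real (Iic r)ᶜ := by
        rw [compl_Iic]
        exact ENNReal.toReal_pos
          ((Measure.mem_support_iff_forall y).1 hy _ (Ioi_mem_nhds hry)).ne' (measure_ne_top _ _)
      rw [measureReal_compl measurableSet_Iic] at h1
      linarith
  have hne : μ ≠ 0 := fun h => hμ 0 (by simp [h])
  obtain ⟨x, hx⟩ := (Measure.nonempty_support_iff).2 hne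
  obtain ⟨y, hy, hxy⟩ : ∃ y ∈ μ.support, y ≠ x := by
    by_contra! hcon
    exact hμ x (measure_mono_null (fun y hy hy' => hy (hcon y hy')) Measure.measure_compl_support)
  rcases lt_or_gt_of_ne hxy with hlt | hlt
  · exact key y x hy hx hlt
  · exact key x y hx hy hlt

lemma IsLowerSet.measurableSet_real {A : Set ℝ} (hA : IsLowerSet A) : MeasurableSet A :=
  hA.ordConnected.measurableSet

/-- The means of `a` over the lower sets of `ℝ` decrease with the lower set, and the overall mean
is nonnegative. -/
structure DecreasingLowerMeans (μ : Measure ℝ) (a : ℝ → ℝ) : Prop where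
  integrable : Integrable a μ
  mul_le_mul : ∀ A B : Set ℝ, IsLowerSet A → IsLowerSet B → A ⊆ B →
    (∫ ρ in B, a ρ ∂μ) * μ.real A ≤ (∫ ρ in A, a ρ ∂μ) * μ.real B
  integral_nonneg : 0 ≤ ∫ ρ, a ρ ∂μ

/-- The function whose integral compares the means of `a` over `A` and over `B`. -/
noncomputable def lowerMeanDiff (μ : Measure ℝ) (a : ℝ → ℝ) (A B : Set ℝ) (ρ : ℝ) : ℝ :=
  A.indicator a ρ * μ.real B - B.indicator a ρ * μ.real A

section

variable {μ : Measure ℝ} {a : ℝ → ℝ} {A B : Set ℝ}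

lemma integrable_lowerMeanDiff (ha : Integrable a μ) (hA : MeasurableSet A)
    (hB : MeasurableSet B) : Integrable (lowerMeanDiff μ a A B) μ :=
  ((ha.indicator hA).mul_const _).sub ((ha.indicator hB).mul_const _)

lemma setIntegral_lowerMeanDiff (ha : Integrable a μ) (hA : MeasurableSet A)
    (hB : MeasurableSet B) (C : Set ℝ) :
    ∫ ρ in C, lowerMeanDiff μ a A B ρ ∂μ =
      (∫ ρ in C ∩ A, a ρ ∂μ) * μ.real B - (∫ ρ in C ∩ B, a ρ ∂μ) * μ.real A := by
  unfold lowerMeanDiff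
  rw [integral_sub ((ha.indicator hA).mul_const _).integrableOn
    ((ha.indicator hB).mul_const _).integrableOn, integral_mul_const, integral_mul_const,
    setIntegral_indicator hA, setIntegral_indicator hB]

lemma integral_lowerMeanDiff (h : Integrable a μ) (hA : IsLowerSet A) (hB : IsLowerSet B) :
    ∫ ρ, lowerMeanDiff μ a A B ρ ∂μ =
      (∫ ρ in A, a ρ ∂μ) * μ.real B - (∫ ρ in B, a ρ ∂μ) * μ.real A := by
  have := setIntegral_lowerMeanDiff h hA.measurableSet_real hB.measurableSet_real univ
  simpa only [Measure.restrict_univ, univ_inter] using this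

lemma lowerMeanDiff_mul (e : ℝ → ℝ) :
    (fun ρ => lowerMeanDiff μ a A B ρ * e ρ) = lowerMeanDiff μ (fun ρ => a ρ * e ρ) A B := by
  ext ρ
  simp only [lowerMeanDiff, indicator_mul_left]
  ring

end

namespace DecreasingLowerMeans

variable {μ : Measure ℝ} [IsFiniteMeasure μ] {a : ℝ → ℝ} {A B : Set ℝ}

lemma setIntegral_nonneg (h : DecreasingLowerMeans μ a) (hμ : μ ≠ 0) (hA : IsLowerSet A) :
    0 ≤ ∫ ρ in A, a ρ ∂μ := by
  have h1 := h.mul_le_mul A univ hA isLowerSet_univ (subset_univ _)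
  rw [Measure.restrict_univ] at h1
  have h2 := mul_nonneg h.integral_nonneg (measureReal_nonneg (μ := μ) (s := A))
  have h3 : 0 < μ.real univ := by
    have : NeZero μ := ⟨hμ⟩
    exact measureReal_univ_pos
  exact nonneg_of_mul_nonneg_left (h2.trans h1) h3

/-- Lower sets of the line form a chain. If `Iic v ⊆ A`, the integral is that of `a` over `Iic v`
times `μ B - μ A`. If `A ⊆ Iic v`, compare the means over `A` and `Iic v ∩ B`, then enlarge `μ (Iic
v ∩ B)` to `μ B`. -/
lemma setIntegral_lowerMeanDiff_nonneg (h : DecreasingLowerMeans μ a) (hμ : μ ≠ 0)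
    (hA : IsLowerSet A) (hB : IsLowerSet B) (hAB : A ⊆ B) (v : ℝ) :
    0 ≤ ∫ ρ in Iic v, lowerMeanDiff μ a A B ρ ∂μ := by
  rw [setIntegral_lowerMeanDiff h.integrable hA.measurableSet_real hB.measurableSet_real]
  rcases (isLowerSet_Iic v).total hA with hv | hv
  · rw [inter_eq_left.2 hv, inter_eq_left.2 (hv.trans hAB), ← mul_sub]
    exact mul_nonneg (h.setIntegral_nonneg hμ (isLowerSet_Iic v))
      (sub_nonneg.2 (measureReal_mono hAB))
  · rw [inter_eq_right.2 hv]
    have h1 := h.mul_le_mul A (Iic v ∩ B) hA ((isLowerSet_Iic v).inter hB) (subset_inter hv hAB)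
    have h2 := mul_le_mul_of_nonneg_left
      (measureReal_mono (μ := μ) (inter_subset_right (s := Iic v) (t := B)))
      (h.setIntegral_nonneg hμ hA)
    linarith

/-- The exponential factor passes inside `lowerMeanDiff`, so Abel summation applies to the
comparison of any two lower sets. -/
lemma mul_exp (h : DecreasingLowerMeans μ a) (hμ : μ ≠ 0) {s : ℝ} (hs : 0 < s)
    (hae : Integrable (fun ρ => a ρ * Real.exp (-ρ * s)) μ) :
    DecreasingLowerMeans μ (fun ρ => a ρ * Real.exp (-ρ * s)) where
  integrable := hae
  mul_le_mul A B hA hB hAB := by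
    have hA' := hA.measurableSet_real
    have hB' := hB.measurableSet_real
    have h1 := integral_mul_exp_nonneg hs (integrable_lowerMeanDiff h.integrable hA' hB')
      (by rw [lowerMeanDiff_mul]; exact integrable_lowerMeanDiff hae hA' hB')
      (h.setIntegral_lowerMeanDiff_nonneg hμ hA hB hAB)
    rw [lowerMeanDiff_mul, integral_lowerMeanDiff hae hA hB] at h1
    linarith
  integral_nonneg := integral_mul_exp_nonneg hs h.integrable hae
    fun v => h.setIntegral_nonneg hμ (isLowerSet_Iic v)

lemma setIntegral_add_const (ha : Integrable a μ) (x : ℝ) (A : Set ℝ) :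
    ∫ ρ in A, (a ρ + x) ∂μ = (∫ ρ in A, a ρ ∂μ) + μ.real A * x := by
  rw [integral_add ha.integrableOn (integrable_const x), setIntegral_const, smul_eq_mul]

lemma add_const (h : DecreasingLowerMeans μ a) {x : ℝ} (hx : 0 ≤ ∫ ρ, (a ρ + x) ∂μ) :
    DecreasingLowerMeans μ (fun ρ => a ρ + x) where
  integrable := h.integrable.add (integrable_const x)
  mul_le_mul A B hA hB hAB := by
    rw [setIntegral_add_const h.integrable, setIntegral_add_const h.integrable]
    have := h.mul_le_mul A B hA hB hAB
    linarith
  integral_nonneg := hx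

lemma integral_mul_exp_pos (h : DecreasingLowerMeans μ a) (hμ : μ ≠ 0) {v : ℝ}
    (hv : 0 < ∫ ρ in Iic v, a ρ ∂μ) {s : ℝ} (hs : 0 < s)
    (hae : Integrable (fun ρ => a ρ * Real.exp (-ρ * s)) μ) :
    0 < ∫ ρ, a ρ * Real.exp (-ρ * s) ∂μ :=
  _root_.integral_mul_exp_pos hs h.integrable hae
    (fun w => h.setIntegral_nonneg hμ (isLowerSet_Iic w)) hv

/-- For a measure that is not carried by a single point, decay followed by a shift that keeps the
integral nonnegative leaves a positive integral over some half-line. -/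
lemma exists_setIntegral_pos (h : DecreasingLowerMeans μ a) (hμ : ∀ ρ : ℝ, μ {ρ}ᶜ ≠ 0) {v : ℝ}
    (hv : 0 < ∫ ρ in Iic v, a ρ ∂μ) {s : ℝ} (hs : 0 < s)
    (hae : Integrable (fun ρ => a ρ * Real.exp (-ρ * s)) μ) {x : ℝ}
    (hx : 0 ≤ ∫ ρ, (a ρ * Real.exp (-ρ * s) + x) ∂μ) :
    ∃ w, 0 < ∫ ρ in Iic w, (a ρ * Real.exp (-ρ * s) + x) ∂μ := by
  have hne : μ ≠ 0 := fun h0 => hμ 0 (by simp [h0])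
  obtain ⟨r, hr0, hr1, hr⟩ : ∃ r, 0 < μ.real (Iic r) ∧ μ.real (Iic r) < μ.real univ ∧
      0 < ∫ ρ in Iic r, a ρ ∂μ := by
    have hv0 : 0 < μ.real (Iic v) := by
      refine measureReal_nonneg.lt_of_ne fun h0 => hv.ne' ?_
      exact setIntegral_measure_zero _ ((measureReal_eq_zero_iff).1 h0.symm)
    obtain ⟨r, hr0, hr1⟩ := exists_Iic_of_not_dirac hμ
    -- The smaller of `v` and `r` serves: it does not have full mass, and its mean is at least the
    -- mean over `Iic v`.
    rcases le_total v r with hvr | hrv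
    · exact ⟨v, hv0, (measureReal_mono (Iic_subset_Iic.2 hvr)).trans_lt hr1, hv⟩
    · refine ⟨r, hr0, hr1, ?_⟩
      have h1 := h.mul_le_mul _ _ (isLowerSet_Iic r) (isLowerSet_Iic v) (Iic_subset_Iic.2 hrv)
      exact pos_of_mul_pos_left ((mul_pos hv hr0).trans_le h1) measureReal_nonneg
  refine ⟨r, ?_⟩
  have hA := isLowerSet_Iic r
  have hB : IsLowerSet (univ : Set ℝ) := isLowerSet_univ
  -- After decay the mean over `Iic r` strictly exceeds the overall mean. The shift keeps this gap
  -- and leaves the overall mean nonnegative.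
  have hlt := _root_.integral_mul_exp_pos hs
    (integrable_lowerMeanDiff h.integrable hA.measurableSet_real hB.measurableSet_real)
    (by rw [lowerMeanDiff_mul]
        exact integrable_lowerMeanDiff hae hA.measurableSet_real hB.measurableSet_real)
    (h.setIntegral_lowerMeanDiff_nonneg hne hA hB (subset_univ _)) (v₀ := r) (by
      rw [setIntegral_lowerMeanDiff h.integrable hA.measurableSet_real hB.measurableSet_real,
        inter_self, inter_univ, ← mul_sub]
      exact mul_pos hr (sub_pos.2 hr1))
  rw [lowerMeanDiff_mul, integral_lowerMeanDiff hae hA hB, Measure.restrict_univ] at hlt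
  have hx' := setIntegral_add_const hae x univ
  rw [Measure.restrict_univ] at hx'
  rw [hx'] at hx
  rw [setIntegral_add_const hae]
  have h2 := mul_nonneg hx hr0.le
  refine pos_of_mul_pos_left (b := μ.real univ) ?_ measureReal_nonneg
  linarith

end DecreasingLowerMeans

/-! ### Laplace transforms of finite measures -/

section LaplaceTransform

variable {μ : Measure ℝ} {G : ℝ → ℝ} {n : ℕ}

/-- The density, with respect to `μ`, of `∑_{k' ≤ k} x_{k'} G(t_k - t_{k'})` for the Laplace
transform `G` of `μ`. -/
noncomputable def stateDensity {n : ℕ} (x t : Fin (n + 1) → ℝ) (k : Fin (n + 1)) (ρ : ℝ) : ℝ :=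
  ∑ k' ∈ Finset.Iic k, x k' * Real.exp (-ρ * (t k - t k'))

lemma stateDensity_mul_exp (x t : Fin (n + 1) → ℝ) (k : Fin (n + 1)) (s ρ : ℝ) :
    stateDensity x t k ρ * Real.exp (-ρ * (s - t k)) =
      ∑ k' ∈ Finset.Iic k, x k' * Real.exp (-ρ * (s - t k')) := by
  rw [stateDensity, Finset.sum_mul]
  refine Finset.sum_congr rfl fun k' _ => ?_
  rw [mul_assoc, ← Real.exp_add]
  ring_nf

lemma Iic_succ_eq_insert (k : Fin n) :
    Finset.Iic k.succ = insert k.succ (Finset.Iic k.castSucc) := by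
  ext i
  simp only [Finset.mem_Iic, Finset.mem_insert, Fin.le_def, Fin.ext_iff, Fin.val_succ,
    Fin.val_castSucc]
  omega

lemma stateDensity_succ (x t : Fin (n + 1) → ℝ) (k : Fin n) :
    stateDensity x t k.succ = fun ρ =>
      stateDensity x t k.castSucc ρ * Real.exp (-ρ * (t k.succ - t k.castSucc)) + x k.succ := by
  ext ρ
  rw [stateDensity_mul_exp, stateDensity, Iic_succ_eq_insert, Finset.sum_insert, add_comm]
  · simp
  · simp [Fin.le_def]

lemma stateDensity_zero (x t : Fin (n + 1) → ℝ) : stateDensity x t 0 = fun _ => x 0 := by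
  ext ρ
  have : Finset.Iic (0 : Fin (n + 1)) = {0} := by
    ext i; simp
  simp [stateDensity, this]

lemma integrable_sum_exp (hint : ∀ s, 0 ≤ s → Integrable (fun ρ : ℝ => Real.exp (-ρ * s)) μ)
    {x t : Fin (n + 1) → ℝ} (ht : StrictMono t) {k : Fin (n + 1)} {s : ℝ} (hs : t k ≤ s) :
    Integrable (fun ρ => ∑ k' ∈ Finset.Iic k, x k' * Real.exp (-ρ * (s - t k'))) μ := by
  refine integrable_finsetSum _ fun k' hk' => (hint _ ?_).const_mul _
  have := ht.monotone (Finset.mem_Iic.1 hk')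
  linarith

lemma integral_sum_exp (hint : ∀ s, 0 ≤ s → Integrable (fun ρ : ℝ => Real.exp (-ρ * s)) μ)
    (hG : ∀ s, 0 ≤ s → G s = ∫ ρ, Real.exp (-ρ * s) ∂μ)
    {x t : Fin (n + 1) → ℝ} (ht : StrictMono t) {k : Fin (n + 1)} {s : ℝ} (hs : t k ≤ s) :
    ∫ ρ, ∑ k' ∈ Finset.Iic k, x k' * Real.exp (-ρ * (s - t k')) ∂μ =
      ∑ k' ∈ Finset.Iic k, x k' * G (s - t k') := by
  have h0 : ∀ k' ∈ Finset.Iic k, 0 ≤ s - t k' := fun k' hk' => by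
    have := ht.monotone (Finset.mem_Iic.1 hk')
    linarith
  rw [integral_finsetSum _ fun k' hk' => (hint _ (h0 k' hk')).const_mul _]
  refine Finset.sum_congr rfl fun k' hk' => ?_
  rw [integral_const_mul, hG _ (h0 k' hk')]

lemma integrable_stateDensity
    (hint : ∀ s, 0 ≤ s → Integrable (fun ρ : ℝ => Real.exp (-ρ * s)) μ)
    {x t : Fin (n + 1) → ℝ} (ht : StrictMono t) (k : Fin (n + 1)) :
    Integrable (stateDensity x t k) μ :=
  integrable_sum_exp hint ht le_rfl

lemma integrable_stateDensity_mul_exp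
    (hint : ∀ s, 0 ≤ s → Integrable (fun ρ : ℝ => Real.exp (-ρ * s)) μ)
    {x t : Fin (n + 1) → ℝ} (ht : StrictMono t) {k : Fin (n + 1)} {s : ℝ} (hs : t k ≤ s) :
    Integrable (fun ρ => stateDensity x t k ρ * Real.exp (-ρ * (s - t k))) μ := by
  simp only [stateDensity_mul_exp]
  exact integrable_sum_exp hint ht hs

lemma Admissible.integral_stateDensity_nonneg
    (hint : ∀ s, 0 ≤ s → Integrable (fun ρ : ℝ => Real.exp (-ρ * s)) μ)
    (hG : ∀ s, 0 ≤ s → G s = ∫ ρ, Real.exp (-ρ * s) ∂μ)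
    {x t : Fin (n + 1) → ℝ} (h : Admissible G x t) (k : Fin (n + 1)) :
    0 ≤ ∫ ρ, stateDensity x t k ρ ∂μ := by
  unfold stateDensity
  rw [integral_sum_exp hint hG h.strictMono le_rfl]
  exact h.nonneg_sums k

variable [IsFiniteMeasure μ]

lemma Admissible.decreasingLowerMeans (hμ : μ ≠ 0)
    (hint : ∀ s, 0 ≤ s → Integrable (fun ρ : ℝ => Real.exp (-ρ * s)) μ)
    (hG : ∀ s, 0 ≤ s → G s = ∫ ρ, Real.exp (-ρ * s) ∂μ)
    {x t : Fin (n + 1) → ℝ} (h : Admissible G x t) (k : Fin (n + 1)) :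
    DecreasingLowerMeans μ (stateDensity x t k) := by
  induction k using Fin.induction with
  | zero =>
    refine ⟨integrable_stateDensity hint h.strictMono 0, fun A B _ _ _ => ?_,
      h.integral_stateDensity_nonneg hint hG 0⟩
    rw [stateDensity_zero, setIntegral_const, setIntegral_const, smul_eq_mul, smul_eq_mul]
    exact le_of_eq (by ring)
  | succ k ih =>
    have hlt : t k.castSucc < t k.succ := h.strictMono k.castSucc_lt_succ
    have hn := h.integral_stateDensity_nonneg hint hG k.succ
    rw [stateDensity_succ] at hn ⊢
    exact (ih.mul_exp hμ (sub_pos.2 hlt)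
      (integrable_stateDensity_mul_exp hint h.strictMono hlt.le)).add_const hn

/-- The initial density is the positive constant `x 0`; each later decay and shift retains a
half-line with positive integral. -/
lemma Admissible.exists_setIntegral_stateDensity_pos (hμ : ∀ ρ : ℝ, μ {ρ}ᶜ ≠ 0)
    (hint : ∀ s, 0 ≤ s → Integrable (fun ρ : ℝ => Real.exp (-ρ * s)) μ)
    (hG : ∀ s, 0 ≤ s → G s = ∫ ρ, Real.exp (-ρ * s) ∂μ)
    {x t : Fin (n + 1) → ℝ} (h : Admissible G x t) (hx : 0 < x 0) (k : Fin (n + 1)) :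
    ∃ v, 0 < ∫ ρ in Iic v, stateDensity x t k ρ ∂μ := by
  have hne : μ ≠ 0 := fun h0 => hμ 0 (by simp [h0])
  induction k using Fin.induction with
  | zero =>
    obtain ⟨r, hr, -⟩ := exists_Iic_of_not_dirac hμ
    refine ⟨r, ?_⟩
    rw [stateDensity_zero, setIntegral_const, smul_eq_mul]
    exact mul_pos hr hx
  | succ k ih =>
    obtain ⟨v, hv⟩ := ih
    have hlt : t k.castSucc < t k.succ := h.strictMono k.castSucc_lt_succ
    have hn := h.integral_stateDensity_nonneg hint hG k.succ
    rw [stateDensity_succ] at hn ⊢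
    exact (h.decreasingLowerMeans hne hint hG k.castSucc).exists_setIntegral_pos hμ hv
      (sub_pos.2 hlt) (integrable_stateDensity_mul_exp hint h.strictMono hlt.le) hn

/-- The last index `k` with `t k ≤ s`, if the process has started by time `s`. -/
lemma exists_last_index {t : Fin (n + 1) → ℝ} (ht : StrictMono t) {s : ℝ} (hs : t 0 ≤ s) :
    ∃ k, t k ≤ s ∧ Finset.univ.filter (fun k' => t k' ≤ s) = Finset.Iic k := by
  have hne : (Finset.univ.filter (fun k' => t k' ≤ s)).Nonempty := ⟨0, by simpa using hs⟩
  have hmem := Finset.max'_mem _ hne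
  simp only [Finset.mem_filter, Finset.mem_univ, true_and] at hmem
  refine ⟨_, hmem, ?_⟩
  ext i
  simp only [Finset.mem_filter, Finset.mem_univ, true_and, Finset.mem_Iic]
  exact ⟨fun hi => Finset.le_max' _ _ (by simpa using hi), fun hi => (ht.monotone hi).trans hmem⟩

lemma kernelProcess_of_lt (G : ℝ → ℝ) {x t : Fin (n + 1) → ℝ} (ht : StrictMono t) {s : ℝ}
    (hs : s < t 0) : kernelProcess G x t s = 0 := by
  unfold kernelProcess
  rw [Finset.filter_false_of_mem, Finset.sum_empty]
  intro k _
  exact not_le.2 (hs.trans_le (ht.monotone (Fin.zero_le k)))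

/-- The Laplace transform of a nonzero measure is a kernel that preserves nonnegativity. -/
theorem preservesNonnegativity_of_laplace (hμ : μ ≠ 0)
    (hint : ∀ s, 0 ≤ s → Integrable (fun ρ : ℝ => Real.exp (-ρ * s)) μ)
    (hG : ∀ s, 0 ≤ s → G s = ∫ ρ, Real.exp (-ρ * s) ∂μ) : PreservesNonnegativity G where
  nonneg s hs := by
    rw [hG s hs]
    exact integral_nonneg fun ρ => (Real.exp_pos _).le
  pos_zero := by
    have : NeZero μ := ⟨hμ⟩
    rw [hG 0 le_rfl]
    simp only [mul_zero, Real.exp_zero, integral_const, smul_eq_mul, mul_one]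
    exact measureReal_univ_pos
  preserves n x t h s _ := by
    rcases lt_or_ge s (t 0) with hs | hs
    · exact (kernelProcess_of_lt G h.strictMono hs).ge
    obtain ⟨k, hk, hset⟩ := exists_last_index h.strictMono hs
    unfold kernelProcess
    rw [hset]
    -- At a jump time no decay has elapsed, and the claim is condition (1) itself.
    rcases hk.eq_or_lt with rfl | hlt
    · exact h.nonneg_sums k
    · rw [← integral_sum_exp hint hG h.strictMono hk]
      simp only [← stateDensity_mul_exp]
      exact ((h.decreasingLowerMeans hμ hint hG k).mul_exp hμ (sub_pos.2 hlt)
        (integrable_stateDensity_mul_exp hint h.strictMono hk)).integral_nonneg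

theorem kernelProcess_pos_of_laplace (hμ : ∀ ρ : ℝ, μ {ρ}ᶜ ≠ 0)
    (hint : ∀ s, 0 ≤ s → Integrable (fun ρ : ℝ => Real.exp (-ρ * s)) μ)
    (hG : ∀ s, 0 ≤ s → G s = ∫ ρ, Real.exp (-ρ * s) ∂μ)
    {x t : Fin (n + 1) → ℝ} (h : Admissible G x t) (hx : 0 < x 0) {s : ℝ} (hs : t 0 < s)
    (hne : ∀ k, k ≠ 0 → s ≠ t k) : 0 < kernelProcess G x t s := by
  have hμ0 : μ ≠ 0 := fun h0 => hμ 0 (by simp [h0])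
  obtain ⟨k, hk, hset⟩ := exists_last_index h.strictMono hs.le
  have hlt : t k < s := by
    rcases eq_or_ne k 0 with rfl | hk0
    · exact hs
    · exact lt_of_le_of_ne hk (hne k hk0).symm
  unfold kernelProcess
  rw [hset, ← integral_sum_exp hint hG h.strictMono hk]
  simp only [← stateDensity_mul_exp]
  obtain ⟨v, hv⟩ := h.exists_setIntegral_stateDensity_pos hμ hint hG hx k
  exact (h.decreasingLowerMeans hμ0 hint hG k).integral_mul_exp_pos hμ0 hv (sub_pos.2 hlt)
    (integrable_stateDensity_mul_exp hint h.strictMono hk)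

end LaplaceTransform

/-! ### Pointwise limits of kernels -/

section Limit

variable {n : ℕ}

/-- The lower triangular matrix `G(t_i - t_j)`, `j ≤ i`, of the admissibility conditions. -/
def kernelMatrix (G : ℝ → ℝ) (t : Fin (n + 1) → ℝ) : Matrix (Fin (n + 1)) (Fin (n + 1)) ℝ :=
  Matrix.of fun i j => if j ≤ i then G (t i - t j) else 0

lemma det_kernelMatrix (G : ℝ → ℝ) (t : Fin (n + 1) → ℝ) :
    (kernelMatrix G t).det = G 0 ^ (n + 1) := by
  rw [Matrix.det_of_isLowerTriangular]
  · simp [kernelMatrix]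
  · intro i j hij
    have : ¬ j ≤ i := not_le.2 (by simpa using hij)
    simp [kernelMatrix, this]

lemma kernelMatrix_mulVec (G : ℝ → ℝ) (x t : Fin (n + 1) → ℝ) (k : Fin (n + 1)) :
    (kernelMatrix G t).mulVec x k = ∑ k' ∈ Finset.Iic k, x k' * G (t k - t k') := by
  simp only [Matrix.mulVec, dotProduct, kernelMatrix, Matrix.of_apply, ite_mul, zero_mul]
  rw [← Finset.sum_filter]
  refine Finset.sum_congr (by ext; simp) fun i _ => mul_comm _ _

/-- A pointwise limit of kernels that preserve nonnegativity preserves nonnegativity. -/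
theorem PreservesNonnegativity.of_tendsto {ι : Type*} {l : Filter ι} [l.NeBot] {H : ι → ℝ → ℝ}
    {G : ℝ → ℝ} (hH : ∀ᶠ m in l, PreservesNonnegativity (H m))
    (hlim : ∀ s, 0 ≤ s → Tendsto (fun m => H m s) l (𝓝 (G s))) (hG : 0 < G 0) :
    PreservesNonnegativity G where
  nonneg s hs := ge_of_tendsto (hlim s hs) (hH.mono fun m hm => hm.nonneg s hs)
  pos_zero := hG
  preserves n x t h s hs := by
    have hA : Tendsto (fun m => kernelMatrix (H m) t) l (𝓝 (kernelMatrix G t)) := by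
      refine tendsto_pi_nhds.2 fun i => tendsto_pi_nhds.2 fun j => ?_
      simp only [kernelMatrix, Matrix.of_apply]
      split_ifs with hij
      · exact hlim _ (sub_nonneg.2 (h.strictMono.monotone hij))
      · exact tendsto_const_nhds
    set y := (kernelMatrix G t).mulVec x with hy
    have hy0 : ∀ k, 0 ≤ y k := fun k => by
      rw [hy, kernelMatrix_mulVec]; exact h.nonneg_sums k
    -- `x` need not be admissible for `H m`. With this `z m` the sums in (1) become `H m 0 ^ (n + 1)
    -- • y`, hence nonnegative. The adjugate is continuous in the matrix, so `z m` tends to a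
    -- positive multiple of `x`.
    set z : ι → Fin (n + 1) → ℝ := fun m => (kernelMatrix (H m) t).adjugate.mulVec y with hz
    have hzlim : Tendsto z l (𝓝 (G 0 ^ (n + 1) • x)) := by
      have h1 : (kernelMatrix G t).adjugate.mulVec y = G 0 ^ (n + 1) • x := by
        rw [hy, Matrix.mulVec_mulVec, Matrix.adjugate_mul, Matrix.smul_mulVec, Matrix.one_mulVec,
          det_kernelMatrix]
      rw [← h1]
      have hc : Continuous fun A : Matrix (Fin (n + 1)) (Fin (n + 1)) ℝ =>
          A.adjugate.mulVec y := by fun_prop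
      exact (hc.tendsto _).comp hA
    have hadm : ∀ᶠ m in l, Admissible (H m) (z m) t := by
      filter_upwards [hH] with m hm
      refine ⟨h.nonneg_times, h.strictMono, fun k => ?_⟩
      rw [← kernelMatrix_mulVec, hz, Matrix.mulVec_mulVec, Matrix.mul_adjugate,
        Matrix.smul_mulVec, Matrix.one_mulVec, det_kernelMatrix]
      exact mul_nonneg (pow_nonneg hm.pos_zero.le _) (hy0 k)
    have hproc : Tendsto (fun m => kernelProcess (H m) (z m) t s) l
        (𝓝 (G 0 ^ (n + 1) * kernelProcess G x t s)) := by
      unfold kernelProcess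
      rw [Finset.mul_sum]
      refine tendsto_finsetSum _ fun k hk => ?_
      rw [← mul_assoc]
      refine (tendsto_pi_nhds.1 hzlim k).mul (hlim _ (sub_nonneg.2 ?_))
      simpa using hk
    refine nonneg_of_mul_nonneg_right (ge_of_tendsto hproc ?_) (pow_pos hG (n + 1))
    filter_upwards [hH, hadm] with m hm ha using hm.preserves n _ t ha s hs

end Limit

/-! ### Taylor series of completely monotone functions -/

namespace CompletelyMonotoneKernel

variable {G : ℝ → ℝ}

/-- The absolute values of the Taylor coefficients of `G` at `s`. -/
noncomputable def taylorCoeff (G : ℝ → ℝ) (k : ℕ) (s : ℝ) : ℝ :=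
  (-1 : ℝ) ^ k * iteratedDerivWithin k G (Ioi 0) s / k.factorial

lemma taylorCoeff_nonneg (hG : CompletelyMonotoneKernel G) (k : ℕ) {s : ℝ} (hs : 0 < s) :
    0 ≤ taylorCoeff G k s :=
  div_nonneg (hG.sign k s hs) (by positivity)

lemma nonneg (hG : CompletelyMonotoneKernel G) {s : ℝ} (hs : 0 < s) : 0 ≤ G s := by
  simpa using hG.sign 0 s hs

lemma iteratedDerivWithin_uIcc (hG : CompletelyMonotoneKernel G) (k : ℕ) {x a s : ℝ} (hx : 0 < x)
    (hxa : x < a) (hs : s ∈ uIcc a x) :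
    iteratedDerivWithin k G (uIcc a x) s = iteratedDerivWithin k G (Ioi 0) s := by
  have hs0 : s ∈ Ioi (0 : ℝ) := by
    rw [uIcc_of_ge hxa.le] at hs
    exact hx.trans_le hs.1
  have hc : ContDiffAt ℝ k G s :=
    ((hG.contDiffOn.of_le (by exact_mod_cast le_top)).contDiffAt (Ioi_mem_nhds hs0))
  rw [iteratedDerivWithin_eq_iteratedDeriv (uniqueDiffOn_uIcc hxa.ne') hc hs,
    iteratedDerivWithin_eq_iteratedDeriv (uniqueDiffOn_Ioi 0) hc hs0]

/-- Cauchy's form of the remainder. Expanding to the left of `a` cancels the alternating signs, so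
every term is nonnegative. -/
lemma exists_taylor_remainder (hG : CompletelyMonotoneKernel G) (n : ℕ) {x a : ℝ} (hx : 0 < x)
    (hxa : x < a) : ∃ ξ ∈ Ioo x a, G x =
      ∑ k ∈ Finset.range (n + 1), taylorCoeff G k a * (a - x) ^ k +
      (n + 1) * taylorCoeff G (n + 1) ξ * (ξ - x) ^ n * (a - x) := by
  have hsub : uIcc a x ⊆ Ioi 0 := by
    rw [uIcc_of_ge hxa.le]
    exact fun s hs => hx.trans_le hs.1
  have hc : ContDiffOn ℝ (n + 1 : ℕ) G (uIcc a x) :=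
    (hG.contDiffOn.mono hsub).of_le (by exact_mod_cast le_top)
  have hd := hc.differentiableOn_iteratedDerivWithin (m := n) (by norm_cast; omega)
    (uniqueDiffOn_uIcc hxa.ne')
  obtain ⟨ξ, hξ, h⟩ := taylor_mean_remainder_cauchy hxa.ne' (hc.of_le (by norm_cast; omega))
    (hd.mono Ioo_subset_Icc_self)
  rw [hG.iteratedDerivWithin_uIcc _ hx hxa (Ioo_subset_Icc_self hξ), taylor_within_apply] at h
  rw [uIoo_of_ge hxa.le] at hξ
  refine ⟨ξ, hξ, ?_⟩
  rw [sub_eq_iff_eq_add'] at h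
  rw [h]
  congr 1
  · refine Finset.sum_congr rfl fun k _ => ?_
    rw [hG.iteratedDerivWithin_uIcc _ hx hxa left_mem_uIcc, taylorCoeff, ← neg_sub a x,
      neg_pow (a - x), smul_eq_mul]
    ring
  · rw [taylorCoeff, ← neg_sub ξ x, neg_pow (ξ - x), Nat.factorial_succ, Nat.cast_mul]
    have h1 : (n.factorial : ℝ) ≠ 0 := by positivity
    have h2 : ((n : ℝ) + 1) ≠ 0 := by positivity
    push_cast
    field_simp
    ring

lemma taylorCoeff_mul_pow_le (hG : CompletelyMonotoneKernel G) (n : ℕ) {x a : ℝ} (hx : 0 < x)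
    (hxa : x < a) : taylorCoeff G n a * (a - x) ^ n ≤ G x := by
  obtain ⟨ξ, hξ, h⟩ := hG.exists_taylor_remainder n hx hxa
  have h1 : taylorCoeff G n a * (a - x) ^ n ≤
      ∑ k ∈ Finset.range (n + 1), taylorCoeff G k a * (a - x) ^ k :=
    Finset.single_le_sum (f := fun k => taylorCoeff G k a * (a - x) ^ k)
      (fun k _ => mul_nonneg (hG.taylorCoeff_nonneg k (hx.trans hxa))
        (pow_nonneg (sub_pos.2 hxa).le _)) (Finset.self_mem_range_succ n)
  have h2 : 0 ≤ (n + 1) * taylorCoeff G (n + 1) ξ * (ξ - x) ^ n * (a - x) := by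
    have := hG.taylorCoeff_nonneg (n + 1) (hx.trans hξ.1)
    have := sub_pos.2 hξ.1
    have := sub_pos.2 hxa
    positivity
  linarith

/-- A completely monotone function is the sum of its Taylor series at `a` on `(0, a)`. -/
lemma hasSum_taylor (hG : CompletelyMonotoneKernel G) {x a : ℝ} (hx : 0 < x) (hxa : x < a) :
    HasSum (fun k => taylorCoeff G k a * (a - x) ^ k) (G x) := by
  rw [hasSum_iff_tendsto_nat_of_nonneg fun k => mul_nonneg
    (hG.taylorCoeff_nonneg k (hx.trans hxa)) (pow_nonneg (sub_pos.2 hxa).le _)]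
  rw [← tendsto_add_atTop_iff_nat 1]
  -- Any point of `(0, x)` would do: `G y` bounds the coefficient at `ξ`, and the ratio `(ξ - x) /
  -- (ξ - y)`, increasing in `ξ`, stays below `q < 1`.
  set y := x / 2 with hy
  have hy0 : 0 < y := by positivity
  have hyx : y < x := by linarith
  set q := (a - x) / (a - y) with hq
  have hq0 : 0 ≤ q := div_nonneg (by linarith) (by linarith)
  have hq1 : q < 1 := (div_lt_one (by linarith)).2 (by linarith)
  set C := (a - x) / (x - y) * G y with hC
  have hbound : ∀ n : ℕ, |∑ k ∈ Finset.range (n + 1), taylorCoeff G k a * (a - x) ^ k - G x| ≤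
      ((n : ℝ) * q ^ n + q ^ n) * C := by
    intro n
    obtain ⟨ξ, ⟨hxξ, hξa⟩, h⟩ := hG.exists_taylor_remainder n hx hxa
    have hcn := hG.taylorCoeff_nonneg (n + 1) (hx.trans hxξ)
    have hle := hG.taylorCoeff_mul_pow_le (n + 1) hy0 (hyx.trans hxξ)
    have e1 : 0 < ξ - x := sub_pos.2 hxξ
    have e2 : 0 < ξ - y := by linarith
    have e3 : 0 < a - x := sub_pos.2 hxa
    have e4 : 0 < x - y := sub_pos.2 hyx
    have e5 : 0 < a - y := by linarith
    have hratio : (ξ - x) / (ξ - y) ≤ q := by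
      rw [hq, div_le_div_iff₀ e2 e5]
      nlinarith
    have hpow : (ξ - x) ^ n ≤ q ^ n * (ξ - y) ^ n := by
      rw [← mul_pow]
      exact pow_le_pow_left₀ e1.le ((div_le_iff₀ e2).1 hratio) n
    have hGy := hG.nonneg hy0
    have hstep : taylorCoeff G (n + 1) ξ * (ξ - y) ^ n ≤ G y / (x - y) := by
      rw [le_div_iff₀ e4]
      refine le_trans ?_ hle
      rw [pow_succ, ← mul_assoc]
      exact mul_le_mul_of_nonneg_left (by linarith) (by positivity)
    rw [abs_sub_comm, h, add_sub_cancel_left, abs_of_nonneg (by positivity)]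
    calc (n + 1) * taylorCoeff G (n + 1) ξ * (ξ - x) ^ n * (a - x)
        ≤ (n + 1) * taylorCoeff G (n + 1) ξ * (q ^ n * (ξ - y) ^ n) * (a - x) := by gcongr
      _ = (n + 1) * q ^ n * (a - x) * (taylorCoeff G (n + 1) ξ * (ξ - y) ^ n) := by ring
      _ ≤ (n + 1) * q ^ n * (a - x) * (G y / (x - y)) := by gcongr
      _ = ((n : ℝ) * q ^ n + q ^ n) * C := by rw [hC]; ring
  have hlim : Tendsto (fun n : ℕ => ((n : ℝ) * q ^ n + q ^ n) * C) atTop (𝓝 0) := by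
    simpa using ((tendsto_self_mul_const_pow_of_lt_one hq0 hq1).add
      (tendsto_pow_atTop_nhds_zero_of_lt_one hq0 hq1)).mul_const C
  exact tendsto_iff_norm_sub_tendsto_zero.2
    (squeeze_zero (fun _ => norm_nonneg _) hbound hlim)

/-! ### Exponential time change -/

/-- The time change whose composition with a completely monotone function is a Laplace transform
of a discrete measure. -/
noncomputable def expTime (a s : ℝ) : ℝ := a * (1 - Real.exp (-(s + a⁻¹) / a))

/-- The shift by `a⁻¹` makes this strict even at `s = 0`, as the Taylor expansion requires. -/
lemma expTime_pos {a s : ℝ} (ha : 0 < a) (hs : 0 ≤ s) : 0 < expTime a s := by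
  refine mul_pos ha (sub_pos.2 (Real.exp_lt_one_iff.2 ?_))
  have : 0 < s + a⁻¹ := by positivity
  exact div_neg_of_neg_of_pos (by linarith) ha

lemma expTime_lt {a s : ℝ} (ha : 0 < a) : expTime a s < a := by
  have := mul_pos ha (Real.exp_pos (-(s + a⁻¹) / a))
  unfold expTime
  linarith

/-- The bound `|exp z - 1 - z| ≤ z ^ 2` puts `expTime a s` within `(s + a⁻¹) ^ 2 / a` of `s + a⁻¹`.
-/
lemma tendsto_expTime (s : ℝ) : Tendsto (fun a => expTime a s) atTop (𝓝 s) := by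
  have hu : Tendsto (fun a : ℝ => s + a⁻¹) atTop (𝓝 s) := by
    simpa using (tendsto_const_nhds (x := s)).add (tendsto_inv_atTop_zero (𝕜 := ℝ))
  have hz : Tendsto (fun a : ℝ => -(s + a⁻¹) / a) atTop (𝓝 0) := by
    simpa [div_eq_mul_inv] using hu.neg.mul tendsto_inv_atTop_zero
  have hdiff : Tendsto (fun a => expTime a s - (s + a⁻¹)) atTop (𝓝 0) := by
    have hb : Tendsto (fun a : ℝ => (s + a⁻¹) ^ 2 * a⁻¹) atTop (𝓝 0) := by
      simpa using (hu.pow 2).mul tendsto_inv_atTop_zero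
    refine squeeze_zero_norm' ?_ hb
    filter_upwards [eventually_gt_atTop 0,
      hz.eventually (Metric.closedBall_mem_nhds (0 : ℝ) one_pos)] with a ha hza
    have h1 := Real.abs_exp_sub_one_sub_id_le (mem_closedBall_zero_iff.1 hza)
    have h2 : expTime a s - (s + a⁻¹) =
        -(a * (Real.exp (-(s + a⁻¹) / a) - 1 - -(s + a⁻¹) / a)) := by
      unfold expTime
      field_simp
      ring
    rw [h2, norm_neg, norm_mul, Real.norm_of_nonneg ha.le, Real.norm_eq_abs]
    calc a * _ ≤ a * (-(s + a⁻¹) / a) ^ 2 := by gcongr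
      _ = (s + a⁻¹) ^ 2 * a⁻¹ := by field_simp
  simpa using hdiff.add hu

/-- The discrete measure whose Laplace transform is `G ∘ expTime a`. -/
noncomputable def expTimeMeasure (G : ℝ → ℝ) (a : ℝ) : Measure ℝ :=
  Measure.sum fun k : ℕ =>
    ENNReal.ofReal (taylorCoeff G k a * (a * Real.exp (-a⁻¹ / a)) ^ k) • Measure.dirac (k / a)

/-- The distance `a - expTime a s` is a constant times `exp (-s / a)`, so its `k`-th power decays in
`s` at rate `k / a`. -/
lemma hasSum_expTime (hG : CompletelyMonotoneKernel G) {a s : ℝ} (ha : 0 < a) (hs : 0 ≤ s) :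
    HasSum (fun k : ℕ => (ENNReal.ofReal
      (taylorCoeff G k a * (a * Real.exp (-a⁻¹ / a)) ^ k)).toReal * Real.exp (-(k / a) * s))
      (G (expTime a s)) := by
  refine (hG.hasSum_taylor (expTime_pos ha hs) (expTime_lt ha)).congr_fun ?_
  intro k
  have hc := hG.taylorCoeff_nonneg k ha
  have h1 : a - expTime a s = a * Real.exp (-a⁻¹ / a) * Real.exp (-s / a) := by
    rw [mul_assoc, ← Real.exp_add, expTime, ← add_div]
    ring_nf
  rw [ENNReal.toReal_ofReal (by positivity), h1, mul_pow (a * _), ← Real.exp_nat_mul (-s / a),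
    mul_assoc]
  ring_nf

lemma integrable_expTimeMeasure (hG : CompletelyMonotoneKernel G) {a s : ℝ} (ha : 0 < a)
    (hs : 0 ≤ s) : Integrable (fun ρ => Real.exp (-ρ * s)) (expTimeMeasure G a) :=
  integrable_sum_dirac (fun _ => ENNReal.ofReal_ne_top)
    (by simpa only [Real.norm_of_nonneg (Real.exp_pos _).le] using
      (hG.hasSum_expTime ha hs).summable)

lemma integral_expTimeMeasure (hG : CompletelyMonotoneKernel G) {a s : ℝ} (ha : 0 < a)
    (hs : 0 ≤ s) : G (expTime a s) = ∫ ρ, Real.exp (-ρ * s) ∂expTimeMeasure G a := by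
  rw [expTimeMeasure, integral_sum_dirac fun _ => ENNReal.ofReal_ne_top]
  simpa only [smul_eq_mul] using (hG.hasSum_expTime ha hs).tsum_eq.symm

lemma preservesNonnegativity_expTime (hG : CompletelyMonotoneKernel G) {a : ℝ} (ha : 0 < a)
    (h0 : 0 < G (expTime a 0)) : PreservesNonnegativity fun s => G (expTime a s) := by
  -- Finiteness is integrability of the exponential at `s = 0`.
  have hfin : IsFiniteMeasure (expTimeMeasure G a) := by
    have := hG.integrable_expTimeMeasure ha le_rfl
    simp only [mul_zero, Real.exp_zero] at this
    exact (integrable_const_iff_isFiniteMeasure one_ne_zero).1 this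
  refine preservesNonnegativity_of_laplace (μ := expTimeMeasure G a) (fun hμ => ?_)
    (fun s hs => hG.integrable_expTimeMeasure ha hs) fun s hs => hG.integral_expTimeMeasure ha hs
  rw [hG.integral_expTimeMeasure ha le_rfl, hμ, integral_zero_measure] at h0
  exact h0.false

lemma continuousWithinAt (hG : CompletelyMonotoneKernel G) {s : ℝ} (hs : 0 ≤ s) :
    ContinuousWithinAt G (Ici 0) s := by
  rcases hs.eq_or_lt with rfl | hs
  · exact hG.continuous_zero
  · exact (hG.contDiffOn.continuousOn.continuousAt (Ioi_mem_nhds hs)).continuousWithinAt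

lemma tendsto_comp_expTime (hG : CompletelyMonotoneKernel G) {s : ℝ} (hs : 0 ≤ s) :
    Tendsto (fun a => G (expTime a s)) atTop (𝓝 (G s)) := by
  refine (hG.continuousWithinAt hs).tendsto.comp
    (tendsto_nhdsWithin_iff.2 ⟨tendsto_expTime s, ?_⟩)
  filter_upwards [eventually_gt_atTop 0] with a ha using (expTime_pos ha hs).le

theorem preservesNonnegativity (hG : CompletelyMonotoneKernel G) (h0 : 0 < G 0) :
    PreservesNonnegativity G := by
  refine PreservesNonnegativity.of_tendsto (l := atTop) (H := fun a s => G (expTime a s)) ?_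
    (fun s hs => hG.tendsto_comp_expTime hs) h0
  filter_upwards [eventually_gt_atTop 0,
    (hG.tendsto_comp_expTime le_rfl).eventually (lt_mem_nhds h0)] with a ha ha0
  exact hG.preservesNonnegativity_expTime ha ha0

end CompletelyMonotoneKernel

theorem theorem2 :
    -- completely monotone kernels preserve nonnegativity
    (∀ G : ℝ → ℝ, CompletelyMonotoneKernel G → 0 < G 0 → PreservesNonnegativity G) ∧
    -- so do Laplace transforms of finite (nonzero) measures on the whole line
    (∀ (μ : Measure ℝ) [IsFiniteMeasure μ] (G : ℝ → ℝ), μ ≠ 0 →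
      (∀ s, 0 ≤ s → Integrable (fun ρ : ℝ => Real.exp (-ρ * s)) μ) →
      (∀ s, 0 ≤ s → G s = ∫ ρ, Real.exp (-ρ * s) ∂μ) →
      PreservesNonnegativity G ∧
      -- strict positivity when `μ` is not carried by a single point
      ((∀ ρ₁ : ℝ, μ {ρ₁}ᶜ ≠ 0) →
        ∀ (n : ℕ) (x t : Fin (n + 1) → ℝ), Admissible G x t → 0 < x 0 →
          ∀ s, t 0 < s → (∀ k, k ≠ 0 → s ≠ t k) → 0 < kernelProcess G x t s)) :=
  ⟨fun _ hG h0 => hG.preservesNonnegativity h0, fun _ _ _ hμ hint hG =>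
    ⟨preservesNonnegativity_of_laplace hμ hint hG,
      fun hμ' _ _ _ h hx _ hs hne => kernelProcess_pos_of_laplace hμ' hint hG h hx hs hne⟩⟩
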